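/- Let $p$ be a prime, let $q$ be a power of $p$, and let $\mathbb{F}_q(t)\langle\partial\rangle$ be the ring of linear differential operators $\sum_i f_i\partial^i$ with $f_i\in\mathbb{F}_q(t)$, whose multiplication is determined by $\partial f=f\partial+\frac{\mathrm{d}f}{\mathrm{d}t}$ for $f\in\mathbb{F}_q(t)$. For an operator $L$, write $\mathcal{D}_L=\mathbb{F}_q(t)\langle\partial\rangle/\mathbb{F}_q(t)\langle\partial\rangle L$; when $L$ is central (for example $L=N(\partial^p)^\nu$ with $N\in\mathbb{F}_q(t^p)[Y]$), this is a ring. Let $N\in\mathbb{F}_q(t^p)[Y]$ be irreducible and separable over $\mathbb{F}_q(t^p)$, and let $\nu\in\mathbb{N}$. Then there is a ring isomorphism $$\mathcal{D}_{N(\partial^p)}[T]/(T^\nu)\;\simeq\;\mathcal{D}_{N(\partial^p)^\nu},$$ where $T$ is a central indeterminate. Moreover, the isomorphism can be chosen so that it sends $T$ to the class of $N(\partial^p)$ and, for every $f\in\mathbb{F}_q(t)$, the class of $f$ to the class of $f$. -/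

import Mathlib

open Polynomial

noncomputable section

/-! ### The derivation `d/dt` on the rational function field -/

namespace RatDer

variable {F : Type*} [Field F]

/-- The function `d/dt` on `F(t)`: the quotient rule applied to the reduced fraction. -/
def derivFun (f : RatFunc F) : RatFunc F :=
  (algebraMap F[X] (RatFunc F) (derivative f.num) * algebraMap F[X] (RatFunc F) f.denom
    - algebraMap F[X] (RatFunc F) f.num * algebraMap F[X] (RatFunc F) (derivative f.denom))
    / algebraMap F[X] (RatFunc F) f.denom ^ 2

/-- The quotient rule holds for every representation of a rational function as a fraction. -/
theorem derivFun_div (a b : F[X]) (hb : b ≠ 0) :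
    derivFun (algebraMap F[X] (RatFunc F) a / algebraMap F[X] (RatFunc F) b) =
      (algebraMap F[X] (RatFunc F) (derivative a) * algebraMap F[X] (RatFunc F) b
        - algebraMap F[X] (RatFunc F) a * algebraMap F[X] (RatFunc F) (derivative b))
        / algebraMap F[X] (RatFunc F) b ^ 2 := by
  set f : RatFunc F := algebraMap F[X] (RatFunc F) a / algebraMap F[X] (RatFunc F) b with hf
  have hd : f.denom ≠ 0 := f.denom_ne_zero
  have hb' : algebraMap F[X] (RatFunc F) b ≠ 0 := RatFunc.algebraMap_ne_zero hb
  have hd' : algebraMap F[X] (RatFunc F) f.denom ≠ 0 := RatFunc.algebraMap_ne_zero hd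
  have h1 : f.num * b = a * f.denom := by
    apply RatFunc.algebraMap_injective F
    rw [map_mul, map_mul]
    have h := RatFunc.num_div_denom f
    nth_rewrite 3 [hf] at h
    rwa [div_eq_div_iff hd' hb'] at h
  have h2 := congrArg derivative h1
  rw [derivative_mul, derivative_mul] at h2
  have e1 := congrArg (algebraMap F[X] (RatFunc F)) h1
  have e2 := congrArg (algebraMap F[X] (RatFunc F)) h2
  simp only [map_mul, map_add] at e1 e2
  unfold derivFun
  rw [div_eq_div_iff (pow_ne_zero 2 hd') (pow_ne_zero 2 hb')]
  linear_combination
    (algebraMap F[X] (RatFunc F) b * algebraMap F[X] (RatFunc F) f.denom) * e2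
    - (algebraMap F[X] (RatFunc F) (derivative b) * algebraMap F[X] (RatFunc F) f.denom
      + algebraMap F[X] (RatFunc F) b * algebraMap F[X] (RatFunc F) (derivative f.denom)) * e1

theorem exists_div (f : RatFunc F) : ∃ a b : F[X], b ≠ 0 ∧
    f = algebraMap F[X] (RatFunc F) a / algebraMap F[X] (RatFunc F) b :=
  ⟨f.num, f.denom, f.denom_ne_zero, (RatFunc.num_div_denom f).symm⟩

theorem derivFun_algebraMap (a : F[X]) :
    derivFun (algebraMap F[X] (RatFunc F) a) = algebraMap F[X] (RatFunc F) (derivative a) := by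
  have h := derivFun_div a 1 one_ne_zero
  simpa using h

theorem derivFun_add (f g : RatFunc F) : derivFun (f + g) = derivFun f + derivFun g := by
  obtain ⟨a, b, hb, rfl⟩ := exists_div f
  obtain ⟨c, d, hd, rfl⟩ := exists_div g
  have hb' : algebraMap F[X] (RatFunc F) b ≠ 0 := RatFunc.algebraMap_ne_zero hb
  have hd' : algebraMap F[X] (RatFunc F) d ≠ 0 := RatFunc.algebraMap_ne_zero hd
  rw [div_add_div _ _ hb' hd', ← map_mul, ← map_mul, ← map_add, ← map_mul,
    derivFun_div _ _ (mul_ne_zero hb hd), derivFun_div _ _ hb, derivFun_div _ _ hd]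
  simp only [derivative_mul, derivative_add, map_mul, map_add]
  field_simp
  ring

theorem derivFun_mul (f g : RatFunc F) :
    derivFun (f * g) = f * derivFun g + g * derivFun f := by
  obtain ⟨a, b, hb, rfl⟩ := exists_div f
  obtain ⟨c, d, hd, rfl⟩ := exists_div g
  have hb' : algebraMap F[X] (RatFunc F) b ≠ 0 := RatFunc.algebraMap_ne_zero hb
  have hd' : algebraMap F[X] (RatFunc F) d ≠ 0 := RatFunc.algebraMap_ne_zero hd
  rw [div_mul_div_comm, ← map_mul, ← map_mul,
    derivFun_div _ _ (mul_ne_zero hb hd), derivFun_div _ _ hb, derivFun_div _ _ hd]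
  simp only [derivative_mul, map_mul, map_add]
  field_simp
  ring

theorem derivFun_C (c : F) : derivFun (RatFunc.C c) = 0 := by
  rw [← RatFunc.algebraMap_C, derivFun_algebraMap, derivative_C, map_zero]

end RatDer

/-- The derivation `d/dt` on the rational function field `F(t)`. -/
def ratDeriv (F : Type*) [Field F] : Derivation F (RatFunc F) (RatFunc F) :=
  Derivation.mk'
    { toFun := RatDer.derivFun
      map_add' := RatDer.derivFun_add
      map_smul' := fun c f => by
        rw [RatFunc.smul_eq_C_mul, RatDer.derivFun_mul, RatDer.derivFun_C, mul_zero, add_zero,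
          RingHom.id_apply, RatFunc.smul_eq_C_mul] }
    (fun f g => RatDer.derivFun_mul f g)

theorem ratDeriv_X (F : Type*) [Field F] : ratDeriv F RatFunc.X = 1 := by
  change RatDer.derivFun RatFunc.X = 1
  rw [← RatFunc.algebraMap_X, RatDer.derivFun_algebraMap, derivative_X, map_one]

/-! ### The ring of linear differential operators -/

/-- The linear differential operators `∑ fᵢ ∂ⁱ` over a commutative ring `K` with a derivation `d`;
the underlying additive group is that of the polynomials `∑ fᵢ Xⁱ`. -/
def DiffOp {R K : Type*} [CommRing R] [CommRing K] [Algebra R K] (_d : Derivation R K K) : Type _ :=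
  K[X]

namespace DiffOp

section Construction

variable {R K : Type*} [CommRing R] [CommRing K] [Algebra R K] (d : Derivation R K K)

instance : AddCommGroup (DiffOp d) := inferInstanceAs (AddCommGroup K[X])

/-- The operator with a given sequence of coefficients, written to the left of the powers of `∂`. -/
def ofPoly : K[X] ≃+ DiffOp d := AddEquiv.refl K[X]

/-- The derivation `d` applied to every coefficient of a polynomial. -/
def coeffDeriv : K[X] →+ K[X] where
  toFun q := ∑ i ∈ q.support, monomial i (d (q.coeff i))
  map_zero' := by simp
  map_add' q r := by
    have key : ∀ s : K[X], ∀ n : ℕ,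
        (∑ i ∈ s.support, monomial i (d (s.coeff i))).coeff n = d (s.coeff n) := by
      intro s n
      simp only [finsetSum_coeff, coeff_monomial, Finset.sum_ite_eq', mem_support_iff]
      split_ifs with h
      · rfl
      · rw [notMem_support_iff.mp h, map_zero]
    ext n
    rw [coeff_add, key, key, key, coeff_add, map_add]

theorem coeff_coeffDeriv (q : K[X]) (n : ℕ) : (coeffDeriv d q).coeff n = d (q.coeff n) := by
  change (∑ i ∈ q.support, monomial i (d (q.coeff i))).coeff n = d (q.coeff n)
  simp only [finsetSum_coeff, coeff_monomial, Finset.sum_ite_eq', mem_support_iff]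
  split_ifs with h
  · rfl
  · rw [notMem_support_iff.mp h, map_zero]

/-- Left multiplication by `∂`: since `∂ f = f ∂ + d f`, it sends `∑ fᵢ ∂ⁱ` to
`∑ fᵢ ∂ⁱ⁺¹ + ∑ (d fᵢ) ∂ⁱ`. -/
def leftD : AddMonoid.End K[X] := AddMonoidHom.mulLeft X + coeffDeriv d

theorem leftD_apply (q : K[X]) : leftD d q = X * q + coeffDeriv d q := rfl

/-- Left multiplication by the operator `∑ fᵢ ∂ⁱ`, namely `∑ fᵢ (leftD d)ⁱ`. -/
def leftMul (L : K[X]) : AddMonoid.End K[X] := eval₂ (Module.toAddMonoidEnd K K[X]) (leftD d) L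

theorem leftMul_add (L M q : K[X]) : leftMul d (L + M) q = leftMul d L q + leftMul d M q := by
  rw [leftMul, eval₂_add]
  rfl

theorem leftMul_monomial (i : ℕ) (f : K) (q : K[X]) :
    leftMul d (monomial i f) q = f • ((leftD d) ^ i) q := by
  rw [leftMul, eval₂_monomial]
  rfl

theorem leftD_smul (f : K) (q : K[X]) : leftD d (f • q) = f • leftD d q + d f • q := by
  ext n
  rcases n with _ | n <;>
  simp [leftD_apply, coeff_coeffDeriv, coeff_X_mul] <;> ring

theorem leftMul_smul (f : K) (L q : K[X]) : leftMul d (f • L) q = f • leftMul d L q := by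
  induction L using Polynomial.induction_on' with
  | add a b ha hb =>
    rw [smul_add, leftMul_add, leftMul_add, ha, hb, smul_add]
  | monomial i g =>
    rw [smul_monomial, leftMul_monomial, leftMul_monomial, smul_smul, smul_eq_mul]

theorem leftMul_leftD (L q : K[X]) : leftMul d (leftD d L) q = leftD d (leftMul d L q) := by
  induction L using Polynomial.induction_on' with
  | add a b ha hb =>
    rw [map_add, leftMul_add, leftMul_add, ha, hb, map_add]
  | monomial i g =>
    have h : leftD d (monomial i g) = monomial (i + 1) g + monomial i (d g) := by
      ext n
      rw [leftD_apply, X_mul_monomial, coeff_add, coeff_coeffDeriv, coeff_add, coeff_monomial,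
        coeff_monomial, coeff_monomial]
      split_ifs <;> simp
    rw [h, leftMul_add, leftMul_monomial, leftMul_monomial, leftMul_monomial,
      leftD_smul, pow_succ']
    rfl

theorem leftMul_leftMul (L M q : K[X]) :
    leftMul d (leftMul d L M) q = leftMul d L (leftMul d M q) := by
  induction L using Polynomial.induction_on' with
  | add a b ha hb =>
    simp only [leftMul_add, ha, hb]
  | monomial i g =>
    rw [leftMul_monomial, leftMul_monomial, leftMul_smul]
    congr 1
    induction i with
    | zero => simp
    | succ i ih =>
      rw [pow_succ']
      change leftMul d (leftD d ((leftD d ^ i) M)) q = leftD d ((leftD d ^ i) (leftMul d M q))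
      rw [leftMul_leftD, ih]

theorem leftMul_one_left (q : K[X]) : leftMul d 1 q = q := by
  rw [leftMul, eval₂_one]
  rfl

theorem leftMul_one_right (L : K[X]) : leftMul d L 1 = L := by
  induction L using Polynomial.induction_on' with
  | add a b ha hb => rw [leftMul_add, ha, hb]
  | monomial i g =>
    have h : ∀ i : ℕ, ((leftD d) ^ i) (1 : K[X]) = X ^ i := by
      intro i
      induction i with
      | zero => simp
      | succ i ih =>
        rw [pow_succ']
        change leftD d ((leftD d ^ i) 1) = _
        rw [ih, leftD_apply, pow_succ']
        have : coeffDeriv d (X ^ i) = 0 := by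
          ext n
          rw [coeff_coeffDeriv, coeff_X_pow]
          split_ifs <;> simp
        rw [this, add_zero]
    rw [leftMul_monomial, h, smul_X_eq_monomial]

/-- The ring `K⟨∂⟩`, with the product `(∑ fᵢ ∂ⁱ) * M = ∑ fᵢ ∂ⁱ(M)` determined by the rule
`∂ f = f ∂ + d f`. -/
instance : Ring (DiffOp d) :=
  { (inferInstance : AddCommGroup (DiffOp d)) with
    one := ofPoly d 1
    mul := fun L M => ofPoly d (leftMul d ((ofPoly d).symm L) ((ofPoly d).symm M))
    left_distrib := fun L M P => map_add (leftMul d L) M P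
    right_distrib := fun L M P => leftMul_add d L M P
    zero_mul := fun L => by
      change leftMul d 0 L = 0
      rw [leftMul, eval₂_zero]
      rfl
    mul_zero := fun L => map_zero (leftMul d L)
    mul_assoc := fun L M P => leftMul_leftMul d L M P
    one_mul := fun L => leftMul_one_left d L
    mul_one := fun L => leftMul_one_right d L }

theorem ofPoly_mul (L M : K[X]) : ofPoly d L * ofPoly d M = ofPoly d (leftMul d L M) := rfl

/-- The operators of order zero: the embedding of `K` into `K⟨∂⟩`. -/
def const : K →+* DiffOp d where
  toFun f := ofPoly d (C f)
  map_zero' := by simp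
  map_one' := rfl
  map_add' f g := by simp
  map_mul' f g := by
    rw [ofPoly_mul]
    congr 1
    rw [← monomial_zero_left, ← monomial_zero_left, ← monomial_zero_left, leftMul_monomial,
      pow_zero, AddMonoid.End.one_apply, smul_monomial, smul_eq_mul]

/-- The operator `∂`. -/
def D : DiffOp d := ofPoly d X

theorem const_mul_ofPoly (f : K) (q : K[X]) : const d f * ofPoly d q = ofPoly d (f • q) := by
  change ofPoly d (C f) * ofPoly d q = _
  rw [ofPoly_mul, ← monomial_zero_left, leftMul_monomial, pow_zero, AddMonoid.End.one_apply]

theorem D_mul_ofPoly (q : K[X]) : D d * ofPoly d q = ofPoly d (leftD d q) := by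
  change ofPoly d X * ofPoly d q = _
  rw [ofPoly_mul, ← monomial_one_one_eq_X, leftMul_monomial, pow_one, one_smul]

/-- The defining commutation rule `∂ f = f ∂ + d f`. -/
theorem D_mul_const (f : K) : D d * const d f = const d f * D d + const d (d f) := by
  change D d * ofPoly d (C f) = const d f * ofPoly d X + ofPoly d (C (d f))
  rw [D_mul_ofPoly, const_mul_ofPoly, ← map_add, leftD_apply]
  congr 1
  rw [X_mul_C, smul_eq_C_mul]
  congr 1
  ext n
  rw [coeff_coeffDeriv, coeff_C, coeff_C]
  split_ifs <;> simp

theorem D_pow (i : ℕ) : D d ^ i = ofPoly d (X ^ i) := by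
  induction i with
  | zero => rw [pow_zero, pow_zero]; rfl
  | succ i ih =>
    rw [pow_succ', ih, D_mul_ofPoly, leftD_apply, ← pow_succ']
    congr 1
    ext n
    rw [coeff_add, coeff_coeffDeriv, coeff_X_pow i]
    split_ifs <;> simp

/-- Every operator is `∑ fᵢ ∂ⁱ`, where the `fᵢ` are the coefficients of its polynomial. -/
theorem ofPoly_eq_sum (q : K[X]) : ofPoly d q = q.sum fun i f => const d f * D d ^ i := by
  conv_lhs => rw [← q.sum_monomial_eq]
  rw [Polynomial.sum, Polynomial.sum, map_sum]
  refine Finset.sum_congr rfl fun i _ => ?_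
  rw [D_pow, const_mul_ofPoly, smul_X_eq_monomial]

end Construction

end DiffOp

/-! ### Quotients by central elements -/

theorem isTwoSided_span_of_commute {A : Type*} [Ring A] {c : A} (hc : ∀ a : A, Commute c a) :
    (Ideal.span {c}).IsTwoSided := by
  refine ⟨fun {x} b hx => ?_⟩
  obtain ⟨a, rfl⟩ := Ideal.mem_span_singleton'.mp hx
  exact Ideal.mem_span_singleton'.mpr ⟨a * b, by rw [mul_assoc, mul_assoc, (hc b).eq]⟩

/-- `T ^ n` is central in `A[T]`, so that `A[T] / T ^ n` is a ring. -/
instance Polynomial.isTwoSided_span_X_pow {A : Type*} [Ring A] (n : ℕ) :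
    (Ideal.span {(X : A[X]) ^ n}).IsTwoSided :=
  isTwoSided_span_of_commute fun q => commute_X_pow q n

/-! ### Differential operators over `F(t)` in characteristic `p` -/

/-- The ring `F(t)⟨∂⟩` of linear differential operators with rational function coefficients. -/
abbrev RatDiffOp (F : Type*) [Field F] : Type _ := DiffOp (ratDeriv F)

/-- The subfield `F(tᵖ)` of `F(t)`. -/
abbrev ratPow (F : Type*) [Field F] (p : ℕ) : IntermediateField F (RatFunc F) :=
  IntermediateField.adjoin F {(RatFunc.X : RatFunc F) ^ p}

namespace RatDiffOp

variable {F : Type*} [Field F] {p : ℕ}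

/-- The operator `N(∂ᵖ)` for a polynomial `N` with coefficients in `F(tᵖ)`. -/
def evalDPow (N : (ratPow F p)[X]) : RatDiffOp F :=
  N.eval₂ ((DiffOp.const (ratDeriv F)).comp (algebraMap (ratPow F p) (RatFunc F)))
    (DiffOp.D (ratDeriv F) ^ p)

/-- The elements of `F(t)` commuting with a given operator, when they contain `F`. -/
def commutingField (c : RatDiffOp F)
    (hF : ∀ a : F, Commute c (DiffOp.const (ratDeriv F) (RatFunc.C a))) :
    IntermediateField F (RatFunc F) where
  carrier := {f | Commute c (DiffOp.const (ratDeriv F) f)}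
  mul_mem' := fun {f g} hf hg => by
    change Commute _ _
    rw [map_mul]
    exact Commute.mul_right hf hg
  add_mem' := fun {f g} hf hg => by
    change Commute _ _
    rw [map_add]
    exact Commute.add_right hf hg
  algebraMap_mem' := hF
  inv_mem' := fun f hf => by
    change Commute _ _
    by_cases h0 : f = 0
    · rw [h0, inv_zero, map_zero]
      exact Commute.zero_right c
    · have h1 : DiffOp.const (ratDeriv F) f * DiffOp.const (ratDeriv F) f⁻¹ = 1 := by
        rw [← map_mul, mul_inv_cancel₀ h0, map_one]
      have h2 : DiffOp.const (ratDeriv F) f⁻¹ * DiffOp.const (ratDeriv F) f = 1 := by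
        rw [← map_mul, inv_mul_cancel₀ h0, map_one]
      exact Commute.units_inv_right (u := ⟨_, _, h1, h2⟩) hf

theorem commute_D_C (a : F) :
    Commute (DiffOp.D (ratDeriv F)) (DiffOp.const (ratDeriv F) (RatFunc.C a)) := by
  change _ * _ = _
  rw [DiffOp.D_mul_const]
  have h : ratDeriv F (RatFunc.C a) = 0 := RatDer.derivFun_C a
  rw [h, map_zero, add_zero]

theorem D_pow_mul_X (n : ℕ) : DiffOp.D (ratDeriv F) ^ n * DiffOp.const (ratDeriv F) RatFunc.X =
    DiffOp.const (ratDeriv F) RatFunc.X * DiffOp.D (ratDeriv F) ^ n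
      + n * DiffOp.D (ratDeriv F) ^ (n - 1) := by
  induction n with
  | zero => simp
  | succ n ih =>
    rw [pow_succ, mul_assoc, DiffOp.D_mul_const, ratDeriv_X, map_one, mul_add, ← mul_assoc, ih,
      mul_one, add_mul, mul_assoc, mul_assoc, Nat.add_sub_cancel, Nat.cast_succ, add_mul, one_mul,
      add_assoc]
    rcases n with _ | n
    · simp
    · simp only [Nat.add_sub_cancel, mul_assoc, ← pow_succ]

/-- In characteristic `p`, the operator `∂ᵖ` commutes with `F(t)`. -/
theorem commute_D_pow_const [CharP F p] (f : RatFunc F) :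
    Commute (DiffOp.D (ratDeriv F) ^ p) (DiffOp.const (ratDeriv F) f) := by
  have hX : (RatFunc.X : RatFunc F) ∈
      commutingField (DiffOp.D (ratDeriv F) ^ p) (fun a => (commute_D_C a).pow_left p) := by
    change _ * _ = _
    have hp : (p : RatDiffOp F) = 0 := by
      rw [← map_natCast ((DiffOp.const (ratDeriv F)).comp (RatFunc.C)) p, CharP.cast_eq_zero,
        map_zero]
    rw [D_pow_mul_X, hp, zero_mul, add_zero]
  have htop := (IntermediateField.adjoin_simple_le_iff (F := F)).mpr hX
  rw [RatFunc.adjoin_X] at htop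
  exact htop (IntermediateField.mem_top (x := f))

/-- In characteristic `p`, the operator `∂` commutes with `F(tᵖ)`. -/
theorem commute_D_const_ratPow [CharP F p] (f : ratPow F p) :
    Commute (DiffOp.D (ratDeriv F)) (DiffOp.const (ratDeriv F) (f : RatFunc F)) := by
  have hX : (RatFunc.X : RatFunc F) ^ p ∈ commutingField (DiffOp.D (ratDeriv F)) commute_D_C := by
    change _ * _ = _
    have hp : (p : RatFunc F) = 0 := by
      rw [← map_natCast (RatFunc.C) p, CharP.cast_eq_zero, map_zero]
    have h : ratDeriv F (RatFunc.X ^ p) = 0 := by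
      rw [Derivation.leibniz_pow, ← Nat.cast_smul_eq_nsmul (RatFunc F), hp, zero_smul]
    rw [DiffOp.D_mul_const, h, map_zero, add_zero]
  exact (IntermediateField.adjoin_simple_le_iff (F := F)).mpr hX f.2

theorem commute_of_generators (c : RatDiffOp F) (hD : Commute c (DiffOp.D (ratDeriv F)))
    (hf : ∀ f, Commute c (DiffOp.const (ratDeriv F) f)) (L : RatDiffOp F) : Commute c L := by
  have h := DiffOp.ofPoly_eq_sum (ratDeriv F) ((DiffOp.ofPoly (ratDeriv F)).symm L)
  rw [AddEquiv.apply_symm_apply] at h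
  rw [h]
  exact Commute.sum_right _ _ _ fun i _ => (hf _).mul_right (hD.pow_right i)

/-- In characteristic `p`, the operator `N(∂ᵖ)` is central. -/
theorem commute_evalDPow [CharP F p] (N : (ratPow F p)[X]) (L : RatDiffOp F) :
    Commute (evalDPow N) L := by
  have key : ∀ M : RatDiffOp F, Commute (DiffOp.D (ratDeriv F) ^ p) M →
      (∀ f : ratPow F p, Commute (DiffOp.const (ratDeriv F) (f : RatFunc F)) M) →
      Commute (evalDPow N) M := by
    intro M h1 h2
    rw [evalDPow, eval₂_eq_sum, Polynomial.sum]
    exact Commute.sum_left _ _ _ fun i _ => (h2 _).mul_left (h1.pow_left i)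
  refine commute_of_generators _ (key _ ?_ ?_) (fun f => key _ ?_ ?_) L
  · exact (Commute.refl _).pow_left p
  · exact fun f => (commute_D_const_ratPow f).symm
  · exact commute_D_pow_const f
  · intro g
    change _ * _ = _
    rw [← map_mul, ← map_mul, mul_comm]

instance isTwoSided_span_evalDPow [CharP F p] (N : (ratPow F p)[X]) :
    (Ideal.span {evalDPow N}).IsTwoSided :=
  isTwoSided_span_of_commute (commute_evalDPow N)

instance isTwoSided_span_evalDPow_pow [CharP F p] (N : (ratPow F p)[X]) (n : ℕ) :
    (Ideal.span {evalDPow N ^ n}).IsTwoSided :=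
  isTwoSided_span_of_commute fun L => (commute_evalDPow N L).pow_left n

end RatDiffOp

/-- The quotient `𝒟_L = F(t)⟨∂⟩ / F(t)⟨∂⟩ L` by the left ideal generated by `L`; it is a ring
as soon as this ideal is two-sided, for instance if `L = N(∂ᵖ) ^ n`. -/
abbrev OpQuot {F : Type*} [Field F] (L : RatDiffOp F) : Type _ := RatDiffOp F ⧸ Ideal.span {L}

end

/-! Put `z = N(∂ᵖ)`, a central non-zero-divisor of `A = F(t)⟨∂⟩`. The task is to lift `A / z` into
`A / z ^ ν` while fixing `F(t)`, and then send `T` to `z`. By the universal property of `A`, such a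
lift is an operator `∂'` with `∂' f = f ∂' + f'`, `∂' ≡ ∂` modulo `z` and `N(∂'ᵖ) ≡ 0` modulo `z ^
ν`.

Take `∂' = ∂ + t⁻¹ c(∂ᵖ)` with `N ∣ c`. Jacobson's formula (`pow_char_add_mul`) gives `∂'ᵖ = ∂ᵖ +
t⁻ᵖ (cᵖ - c)(∂ᵖ)`, so the last condition becomes the commutative congruence `N(Y + t⁻ᵖ (cᵖ - c)) ≡
0` modulo `N ^ ν`. Its derivative in `c` is `-t⁻ᵖ N'` modulo `N`, a unit by separability, and Newton
iteration solves it (`exists_dvd_pow_dvd_comp`). Successive approximation along powers of `z` then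
gives bijectivity (`exists_ringEquiv_quotient_pow`). -/

/-! ### Trivializing a thickening by a central element -/

/-- A central non-zero-divisor `z` and an endomorphism that is the identity modulo `z` and kills
`z` modulo `z ^ n` trivialize the thickening `A / z ^ n` of `A / z`. -/
theorem exists_ringEquiv_quotient_pow {A : Type*} [Ring A] {z : A} (hz : ∀ a : A, Commute z a)
    (hreg : ∀ a : A, z * a = 0 → a = 0) (n : ℕ)
    [(Ideal.span {z}).IsTwoSided] [(Ideal.span {z ^ n}).IsTwoSided]
    (ψ : A →+* A) (hψ : ∀ a, z ∣ ψ a - a) (hψz : z ^ n ∣ ψ z) :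
    ∃ e : ((A ⧸ Ideal.span {z})[X] ⧸ Ideal.span {(X : (A ⧸ Ideal.span {z})[X]) ^ n}) ≃+*
        A ⧸ Ideal.span {z ^ n},
      e (Ideal.Quotient.mk _ X) = Ideal.Quotient.mk _ z ∧
      ∀ a : A, e (Ideal.Quotient.mk _ (C (Ideal.Quotient.mk _ a))) =
          Ideal.Quotient.mk _ (ψ a) := by
  have mem_span : ∀ (m : ℕ) (a : A), a ∈ Ideal.span {z ^ m} ↔ z ^ m ∣ a := by
    intro m a
    rw [Ideal.mem_span_singleton']
    constructor
    · rintro ⟨b, rfl⟩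
      exact ⟨b, ((hz b).pow_left m).eq.symm⟩
    · rintro ⟨b, rfl⟩
      exact ⟨b, ((hz b).pow_left m).eq.symm⟩
  have mem_span_one : ∀ a : A, a ∈ Ideal.span {z} ↔ z ∣ a := by
    intro a
    simpa using mem_span 1 a
  let φ₀ : A ⧸ Ideal.span {z} →+* A ⧸ Ideal.span {z ^ n} :=
    Ideal.Quotient.lift (Ideal.span {z}) ((Ideal.Quotient.mk _).comp ψ) (by
      intro a ha
      obtain ⟨b, rfl⟩ := (mem_span_one a).mp ha
      rw [RingHom.comp_apply, Ideal.Quotient.eq_zero_iff_mem, mem_span, map_mul]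
      exact hψz.mul_right _)
  have hφ₀ : ∀ a, φ₀ (Ideal.Quotient.mk _ a) = Ideal.Quotient.mk _ (ψ a) := fun a => rfl
  let φ₁ : (A ⧸ Ideal.span {z})[X] →+* A ⧸ Ideal.span {z ^ n} :=
    eval₂RingHom' φ₀ (Ideal.Quotient.mk _ z) (by
      intro a
      obtain ⟨a, rfl⟩ := Ideal.Quotient.mk_surjective a
      rw [hφ₀]
      exact ((hz (ψ a)).map (Ideal.Quotient.mk (Ideal.span {z ^ n}))).symm)
  have hφX : φ₁ X = Ideal.Quotient.mk _ z := eval₂_X _ _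
  have hφC : ∀ a, φ₁ (C a) = φ₀ a := fun a => eval₂_C _ _
  -- `Φ` lifts `φ₁` to honest elements of `A`, where divisibility by `z` can be iterated and `z`
  -- cancelled.
  let Φ : A[X] →+* A := eval₂RingHom' ψ z fun a => (hz (ψ a)).symm
  have hΦX : Φ X = z := eval₂_X _ _
  have hΦC : ∀ a, Φ (C a) = ψ a := fun a => eval₂_C _ _
  have hφΦ : ∀ q : A[X], φ₁ (q.map (Ideal.Quotient.mk _)) = Ideal.Quotient.mk _ (Φ q) := by
    intro q
    induction q using Polynomial.induction_on' with
    | add q r hq hr => rw [Polynomial.map_add, map_add, hq, hr, map_add, map_add]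
    | monomial i a =>
      rw [← C_mul_X_pow_eq_monomial, Polynomial.map_mul, Polynomial.map_pow, map_C, map_X, map_mul,
        map_pow, hφX, hφC, hφ₀, map_mul, map_pow, hΦX, hΦC, map_mul, map_pow]
  -- The constant coefficient of `q` is divisible by `z`, so its image under `ψ` is divisible by `z
  -- ^ n`. The bound `m ≤ n` lets this term be dropped; cancelling one `z` from the rest leaves the
  -- same problem for `q.divX`.
  have hker : ∀ m ≤ n, ∀ q : A[X], z ^ m ∣ Φ q →
      X ^ m ∣ q.map (Ideal.Quotient.mk (Ideal.span {z})) := by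
    intro m
    induction m with
    | zero => intro _ q _; simp
    | succ m ih =>
      intro hm q hq
      have hdecomp := q.divX_mul_X_add
      have hΦ : Φ q = z * Φ q.divX + ψ (q.coeff 0) := by
        conv_lhs => rw [← hdecomp]
        rw [map_add, map_mul, hΦX, hΦC, (hz _).eq]
      have h0 : z ∣ q.coeff 0 := by
        have h1 : z ∣ ψ (q.coeff 0) := by
          have h2 : z ∣ Φ q := (dvd_pow_self z m.succ_ne_zero).trans hq
          rw [hΦ] at h2
          exact (dvd_add_right (dvd_mul_right z _)).mp h2
        exact (dvd_sub_right h1).mp (hψ _)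
      have h3 : z ^ (m + 1) ∣ ψ (q.coeff 0) := by
        obtain ⟨a, ha⟩ := h0
        rw [ha, map_mul]
        exact ((pow_dvd_pow z hm).trans hψz).mul_right _
      rw [hΦ, dvd_add_left h3] at hq
      have h4 : z ^ m ∣ Φ q.divX := by
        obtain ⟨b, hb⟩ := hq
        refine ⟨b, sub_eq_zero.mp (hreg _ ?_)⟩
        rw [mul_sub, hb, pow_succ', mul_assoc, sub_self]
      obtain ⟨r, hr⟩ := ih (Nat.le_of_succ_le hm) _ h4
      refine ⟨r, ?_⟩
      rw [← hdecomp, Polynomial.map_add, Polynomial.map_mul, map_X, map_C,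
        Ideal.Quotient.eq_zero_iff_mem.mpr ((mem_span_one _).mpr h0), C_0, add_zero, hr,
        mul_assoc, ← X_mul, ← mul_assoc, pow_succ]
  have hsurj : ∀ (b : A) (m : ℕ), ∃ q : A[X], z ^ m ∣ b - Φ q := by
    intro b m
    induction m with
    | zero => exact ⟨0, by simp⟩
    | succ m ih =>
      obtain ⟨q, c, hc⟩ := ih
      obtain ⟨d, hd⟩ := hψ c
      -- The old error is `z ^ m * c`; the new one is `z ^ m * (c - ψ c)`, which gains a factor `z`
      -- because `ψ` is the identity modulo `z`.
      refine ⟨q + C c * X ^ m, -d, ?_⟩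
      rw [map_add, map_mul, map_pow, hΦX, hΦC, ← sub_sub, hc, ← ((hz (ψ c)).pow_left m).eq,
        ← mul_sub, ← neg_sub, hd, pow_succ, mul_neg, mul_neg, mul_assoc]
  have hφn : ∀ q ∈ Ideal.span {(X : (A ⧸ Ideal.span {z})[X]) ^ n}, φ₁ q = 0 := by
    intro q hq
    obtain ⟨r, rfl⟩ := Ideal.mem_span_singleton'.mp hq
    rw [map_mul, map_pow, hφX, ← map_pow,
      Ideal.Quotient.eq_zero_iff_mem.mpr (Ideal.mem_span_singleton_self _), mul_zero]
  let φ₂ := Ideal.Quotient.lift _ φ₁ hφn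
  have hφ₂ : ∀ q, φ₂ (Ideal.Quotient.mk _ q) = φ₁ q := fun q => rfl
  have hbij : Function.Bijective φ₂ := by
    constructor
    · rw [injective_iff_map_eq_zero]
      intro a ha
      obtain ⟨q, rfl⟩ := Ideal.Quotient.mk_surjective a
      obtain ⟨q, rfl⟩ := Polynomial.map_surjective _ Ideal.Quotient.mk_surjective q
      rw [hφ₂, hφΦ, Ideal.Quotient.eq_zero_iff_mem, mem_span] at ha
      obtain ⟨r, hr⟩ := hker n le_rfl q ha
      rw [Ideal.Quotient.eq_zero_iff_mem, Ideal.mem_span_singleton']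
      exact ⟨r, by rw [hr, X_pow_mul]⟩
    · intro b
      obtain ⟨b, rfl⟩ := Ideal.Quotient.mk_surjective b
      obtain ⟨q, hq⟩ := hsurj b n
      refine ⟨Ideal.Quotient.mk _ (q.map (Ideal.Quotient.mk _)), ?_⟩
      rw [hφ₂, hφΦ]
      exact (Ideal.Quotient.eq.mpr ((mem_span n _).mpr hq)).symm
  exact ⟨RingEquiv.ofBijective φ₂ hbij, hφX, fun a => (hφC _).trans (hφ₀ a)⟩

/-! ### Jacobson's formula under a Weyl relation in characteristic `p` -/

/-- Both sides are monic of degree `p` and vanish on all of `ZMod p`, so their difference has degree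
below `p` but `p` roots. -/
theorem descPochhammer_zmod (p : ℕ) [Fact p.Prime] :
    descPochhammer (ZMod p) p = X ^ p - X := by
  have hp : 1 < p := (Fact.out : p.Prime).one_lt
  rw [← sub_eq_zero]
  by_contra hne
  have hdeg : (X ^ p - X : (ZMod p)[X]).natDegree = p :=
    FiniteField.X_pow_card_sub_X_natDegree_eq (ZMod p) hp
  have hmonic : (X ^ p - X : (ZMod p)[X]).Monic := monic_X_pow_sub (by simpa using hp)
  have hlt : (descPochhammer (ZMod p) p - (X ^ p - X)).degree < (p : WithBot ℕ) := by
    have h := degree_sub_lt_left (p := descPochhammer (ZMod p) p) (q := X ^ p - X)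
      (by rw [degree_eq_natDegree (monic_descPochhammer (ZMod p) p).ne_zero,
          degree_eq_natDegree hmonic.ne_zero, hdeg, descPochhammer_natDegree])
      (monic_descPochhammer (ZMod p) p).ne_zero
      (by rw [(monic_descPochhammer (ZMod p) p).leadingCoeff, hmonic.leadingCoeff])
    rwa [degree_eq_natDegree (monic_descPochhammer (ZMod p) p).ne_zero,
      descPochhammer_natDegree] at h
  refine hne (eq_zero_of_degree_lt_of_eval_finset_eq_zero Finset.univ ?_ fun a _ => ?_)
  · rwa [Finset.card_univ, ZMod.card]
  · rw [eval_sub, descPochhammer_eval_eq_prod_range, eval_sub, eval_pow, eval_X, ZMod.pow_card,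
      sub_self, sub_zero]
    refine Finset.prod_eq_zero (Finset.mem_range.mpr a.val_lt) ?_
    rw [ZMod.natCast_zmod_val, sub_self]

section Weyl

variable {A : Type*} [Ring A] {x D : A}

/-- The trailing `D` avoids the exponent `n - 1` of the usual commutation formula. -/
theorem pow_mul_of_mul_eq_mul_add_one (h : D * x = x * D + 1) (n : ℕ) :
    D ^ n * x * D = x * D ^ (n + 1) + n * D ^ n := by
  induction n with
  | zero => simp
  | succ n ih =>
    calc D ^ (n + 1) * x * D = D * (D ^ n * x * D) := by simp only [pow_succ', mul_assoc]
      _ = D * x * D ^ (n + 1) + n * D ^ (n + 1) := by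
        rw [ih, mul_add, ← mul_assoc, ← mul_assoc, ← (Nat.cast_commute n D).eq, mul_assoc (n : A),
          ← pow_succ']
      _ = _ := by
        rw [h, add_mul, one_mul, mul_assoc, ← pow_succ', Nat.cast_succ, add_mul, one_mul]
        abel

/-- Multiplying `x ^ n * D ^ n` on the right by `x * D - n` raises both exponents by one, since the
extra term `n * D ^ n` cancels. -/
theorem aeval_descPochhammer_mul_eq (h : D * x = x * D + 1) (n : ℕ) :
    aeval (x * D) (descPochhammer ℤ n) = x ^ n * D ^ n := by
  induction n with
  | zero => simp
  | succ n ih =>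
    rw [descPochhammer_succ_right, map_mul, ih, map_sub, aeval_X, map_natCast, mul_sub,
      mul_assoc, ← mul_assoc (D ^ n), pow_mul_of_mul_eq_mul_add_one h, mul_add,
      mul_assoc (x ^ n) (D ^ n), ← (Nat.cast_commute n (D ^ n)).eq, add_sub_cancel_right,
      ← mul_assoc, ← pow_succ]

theorem pow_char_mul_pow_char (p : ℕ) [Fact p.Prime] [CharP A p] (h : D * x = x * D + 1) :
    x ^ p * D ^ p = (x * D) ^ p - x * D := by
  let _ := ZMod.algebra A p
  rw [← aeval_descPochhammer_mul_eq h, ← aeval_map_algebraMap (ZMod p), descPochhammer_map,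
    descPochhammer_zmod]
  simp

/-- A special case of Jacobson's formula for `(D + g) ^ p`. -/
theorem pow_char_add_mul (p : ℕ) [Fact p.Prime] [CharP A p] (h : D * x = x * D + 1) {y c : A}
    (hxy : x * y = 1) (hyx : y * x = 1) (hcx : Commute c x) (hcD : Commute c D) :
    (D + y * c) ^ p = D ^ p + y ^ p * (c ^ p - c) := by
  have hcy : Commute c y := Commute.units_inv_right (u := ⟨x, y, hxy, hyx⟩) hcx
  -- `D + y * c` obeys the same Weyl relation, so `pow_char_mul_pow_char` applies to it as well as
  -- to `D`. As `x * (D + y * c) = x * D + c` with commuting summands, comparing the two identities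
  -- leaves `c ^ p - c`.
  have h' : (D + y * c) * x = x * (D + y * c) + 1 := by
    rw [add_mul, h, mul_assoc y, hcx.eq, ← mul_assoc y, hyx, mul_add, ← mul_assoc x y, hxy]
    abel
  have key := pow_char_mul_pow_char p h'
  rw [mul_add, ← mul_assoc x, hxy, one_mul,
    add_pow_char_of_commute p (hcx.symm.mul_left hcD.symm), add_sub_add_comm,
    ← pow_char_mul_pow_char p h] at key
  have hyxp : y ^ p * x ^ p = 1 := by
    rw [← (show Commute y x from hyx.trans hxy.symm).mul_pow, hyx, one_pow]
  calc (D + y * c) ^ p = y ^ p * (x ^ p * (D + y * c) ^ p) := by rw [← mul_assoc, hyxp, one_mul]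
    _ = _ := by rw [key, mul_add, ← mul_assoc, hyxp, one_mul]

end Weyl

/-! ### Solving the congruence modulo powers of `N` -/

/-- Newton iteration for the equation `N (X + w (c ^ p - c)) ≡ 0` modulo powers of `N`. -/
theorem exists_dvd_pow_dvd_comp {k : Type*} [Field k] (p : ℕ) [Fact p.Prime] [CharP k p] {N : k[X]}
    (hN : N.Separable) {w : k} (hw : w ≠ 0) (n : ℕ) :
    ∃ c : k[X], N ∣ c ∧ N ^ n ∣ N.comp (X + C w * (c ^ p - c)) := by
  have hp2 : 2 ≤ p := (Fact.out : p.Prime).two_le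
  -- With exponent `n + 1`, the residue `r` below is always divisible by `N`.
  suffices h : ∃ c : k[X], N ∣ c ∧ N ^ (n + 1) ∣ N.comp (X + C w * (c ^ p - c)) by
    obtain ⟨c, hc, h⟩ := h
    exact ⟨c, hc, (pow_dvd_pow N n.le_succ).trans h⟩
  induction n with
  | zero => exact ⟨0, dvd_zero _, by simp [(Fact.out : p.Prime).ne_zero]⟩
  | succ n ih =>
    obtain ⟨c, hc, hr⟩ := ih
    obtain ⟨a, b, hab⟩ := hN
    set Z := X + C w * (c ^ p - c) with hZ
    set r := N.comp Z with hr_def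
    have hww : C w * C w⁻¹ = (1 : k[X]) := by rw [← C_mul, mul_inv_cancel₀ hw, C_1]
    -- The Newton correction: `b` inverts `N'` modulo `N`, and replacing `c` by `c + s` changes `Z`
    -- by `-w s` to first order, as `s ^ p` is already a multiple of `r ^ 2`.
    set s : k[X] := C w⁻¹ * b * r with hs
    have hrs : r ∣ s := dvd_mul_left _ _
    have hNs : N ∣ s := ((dvd_pow_self N n.succ_ne_zero).trans hr).trans hrs
    have hr2 : N ^ (n + 2) ∣ r ^ 2 := by
      refine (pow_dvd_pow N (by omega : n + 2 ≤ (n + 1) * 2)).trans ?_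
      rw [pow_mul]
      exact pow_dvd_pow_of_dvd hr 2
    refine ⟨c + s, dvd_add hc hNs, ?_⟩
    have hZ' : X + C w * ((c + s) ^ p - (c + s)) = Z + C w * (s ^ p - s) := by
      rw [add_pow_char, hZ]; ring
    -- Regarding `N` as a polynomial over `k[X]` turns composition into evaluation, so the
    -- second-order Taylor expansion applies.
    obtain ⟨κ, hκ⟩ := binomExpansion (N.map C) Z (C w * (s ^ p - s))
    simp only [derivative_map, eval_map] at hκ
    change N.comp _ = N.comp _ + (derivative N).comp _ * _ + _ at hκ
    rw [hZ', hκ, ← hr_def]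
    have hZX : N ∣ (derivative N).comp Z - derivative N := by
      have h := sub_dvd_eval_sub Z X ((derivative N).map C)
      rw [eval_map, eval_map] at h
      change _ ∣ (derivative N).comp Z - (derivative N).comp X at h
      rw [comp_X] at h
      refine dvd_trans ?_ h
      rw [hZ, add_sub_cancel_left]
      exact ((dvd_pow hc (by omega)).sub hc).mul_left _
    obtain ⟨g, hg⟩ := hZX
    obtain ⟨f, hf⟩ := hrs
    obtain ⟨m, hm⟩ := Nat.exists_eq_add_of_le hp2
    have h1 : N ^ (n + 2) ∣ N * r := by
      rw [pow_succ']; exact mul_dvd_mul_left N hr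
    have hsp : s ^ p = r ^ 2 * (f ^ 2 * s ^ m) := by
      rw [hm, pow_add, hf]; ring
    have hs2 : s ^ 2 = r ^ 2 * f ^ 2 := by rw [hf]; ring
    -- The first-order terms in `r` cancel modulo `N`; what remains is a multiple of `N * r` plus a
    -- multiple of `r ^ 2`, both divisible by `N ^ (n + 2)`.
    have e : r + (derivative N).comp Z * (C w * (s ^ p - s)) + κ * (C w * (s ^ p - s)) ^ 2 =
        N * r * (a - g * b) + r ^ 2 * ((derivative N).comp Z * C w * (f ^ 2 * s ^ m)
          + κ * C w ^ 2 * f ^ 2 * (s ^ (p - 1) - 1) ^ 2) := by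
      have hsp1 : s ^ p - s = s * (s ^ (p - 1) - 1) := by
        rw [mul_sub, mul_one, ← pow_succ', Nat.sub_add_cancel (by omega)]
      have hd : (derivative N).comp Z * (C w * s) = r - N * r * (a - g * b) := by
        rw [sub_eq_iff_eq_add.mp hg, hs]
        linear_combination ((N * g + derivative N) * b * r) * hww + r * hab
      have h2 : (C w * (s ^ p - s)) ^ 2 = r ^ 2 * (C w ^ 2 * f ^ 2 * (s ^ (p - 1) - 1) ^ 2) := by
        rw [hsp1, mul_pow, mul_pow, hs2]; ring
      rw [h2, mul_sub, mul_sub, hd, hsp]; ring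
    rw [e]
    exact dvd_add (h1.mul_right _) (hr2.mul_right _)

/-! ### Universal property of the ring of differential operators -/

namespace DiffOp

section Lift

variable {R K : Type*} [CommRing R] [CommRing K] [Algebra R K] (d : Derivation R K K)

theorem coeffDeriv_monomial (i : ℕ) (g : K) :
    coeffDeriv d (monomial i g) = monomial i (d g) := by
  ext n
  rw [coeff_coeffDeriv, coeff_monomial, coeff_monomial]
  split_ifs <;> simp

variable {B : Type*} [Ring B] (φ : K →+* B) (b : B)

theorem eval₂_smul_left (f : K) (q : K[X]) : (f • q).eval₂ φ b = φ f * q.eval₂ φ b := by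
  induction q using Polynomial.induction_on' with
  | add q r hq hr => rw [smul_add, eval₂_add, eval₂_add, hq, hr, mul_add]
  | monomial i g =>
    rw [smul_monomial, eval₂_monomial, eval₂_monomial, smul_eq_mul, map_mul, mul_assoc]

variable {d φ b}

theorem eval₂_leftD (h : ∀ f, b * φ f = φ f * b + φ (d f)) (q : K[X]) :
    (leftD d q).eval₂ φ b = b * q.eval₂ φ b := by
  induction q using Polynomial.induction_on' with
  | add q r hq hr => rw [map_add, eval₂_add, eval₂_add, hq, hr, mul_add]
  | monomial i g =>
    rw [leftD_apply, X_mul_monomial, coeffDeriv_monomial, eval₂_add, eval₂_monomial,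
      eval₂_monomial, eval₂_monomial, ← mul_assoc, h, add_mul, mul_assoc, ← pow_succ']

/-- The relation `h` makes evaluation intertwine `leftD` with left multiplication by `b`; the
general product is built from `leftD` and scalars. -/
theorem eval₂_leftMul (h : ∀ f, b * φ f = φ f * b + φ (d f)) (L q : K[X]) :
    (leftMul d L q).eval₂ φ b = L.eval₂ φ b * q.eval₂ φ b := by
  induction L using Polynomial.induction_on' with
  | add L M hL hM => rw [leftMul_add, eval₂_add, eval₂_add, hL, hM, add_mul]
  | monomial i g =>
    rw [leftMul_monomial, eval₂_smul_left, eval₂_monomial, mul_assoc]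
    congr 1
    induction i with
    | zero => simp
    | succ i ih =>
      rw [pow_succ', pow_succ', mul_assoc, ← ih]
      exact eval₂_leftD h _

variable (d φ b)

/-- The universal property of `K⟨∂⟩`. -/
noncomputable def lift (h : ∀ f, b * φ f = φ f * b + φ (d f)) : DiffOp d →+* B where
  toFun L := ((ofPoly d).symm L).eval₂ φ b
  map_zero' := by rw [map_zero, eval₂_zero]
  map_one' := eval₂_one φ b
  map_add' L M := by rw [map_add, eval₂_add]
  map_mul' L M := eval₂_leftMul h _ _

variable (h : ∀ f, b * φ f = φ f * b + φ (d f))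

theorem lift_const (f : K) : lift d φ b h (const d f) = φ f := eval₂_C φ b

theorem lift_D : lift d φ b h (D d) = b := eval₂_X φ b

variable {d} in
theorem ringHom_ext {α β : DiffOp d →+* B} (hconst : ∀ f, α (const d f) = β (const d f))
    (hD : α (D d) = β (D d)) : α = β := by
  ext L
  obtain ⟨q, rfl⟩ := (ofPoly d).surjective L
  rw [ofPoly_eq_sum, Polynomial.sum, map_sum, map_sum]
  refine Finset.sum_congr rfl fun i _ => ?_
  rw [map_mul, map_mul, map_pow, map_pow, hconst, hD]

theorem const_injective : Function.Injective (const d) := fun _ _ h =>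
  C_injective ((ofPoly d).injective h)

theorem ofPoly_mul_D_pow (q : K[X]) (i : ℕ) : ofPoly d q * D d ^ i = ofPoly d (q * X ^ i) := by
  induction q using Polynomial.induction_on' with
  | add q r hq hr => rw [map_add, add_mul, hq, hr, add_mul, map_add]
  | monomial j f =>
    rw [← smul_X_eq_monomial, ← const_mul_ofPoly, mul_assoc, ← D_pow, ← pow_add, D_pow,
      const_mul_ofPoly, smul_mul_assoc, ← pow_add]

end Lift

end DiffOp

/-! ### The twisting endomorphism of `F(t)⟨∂⟩` -/

namespace RatDiffOp

variable {F : Type*} [Field F] {p : ℕ}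

/-- The field element `t ^ (-p)` of `F(tᵖ)`. -/
noncomputable def invXPow (F : Type*) [Field F] (p : ℕ) : ratPow F p :=
  ⟨(RatFunc.X ^ p)⁻¹, inv_mem (IntermediateField.mem_adjoin_simple_self F _)⟩

theorem invXPow_ne_zero : invXPow F p ≠ 0 := fun h =>
  inv_ne_zero (pow_ne_zero p RatFunc.X_ne_zero) (congrArg Subtype.val h)

variable [CharP F p]

theorem charP : CharP (RatDiffOp F) p :=
  charP_of_injective_ringHom (f := (DiffOp.const (ratDeriv F)).comp RatFunc.C)
    ((DiffOp.const_injective _).comp (RingHom.injective (RatFunc.C (K := F)))) p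

variable (F p) in
/-- The substitution `N ↦ N(∂ᵖ)` as a ring homomorphism. -/
noncomputable def evalDPowHom : (ratPow F p)[X] →+* RatDiffOp F :=
  eval₂RingHom' ((DiffOp.const (ratDeriv F)).comp (algebraMap (ratPow F p) (RatFunc F)))
    (DiffOp.D (ratDeriv F) ^ p) fun f => (commute_D_pow_const (f : RatFunc F)).symm

theorem evalDPowHom_apply (N : (ratPow F p)[X]) : evalDPowHom F p N = evalDPow N := rfl

theorem evalDPowHom_X : evalDPowHom F p X = DiffOp.D (ratDeriv F) ^ p := eval₂_X _ _

theorem evalDPowHom_C (f : ratPow F p) :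
    evalDPowHom F p (C f) = DiffOp.const (ratDeriv F) (f : RatFunc F) := eval₂_C _ _

/-- Since `∂ᵖ` is central, its powers can be moved to the right, where no derivatives appear. The
product becomes one of commutative polynomials over a field, so `N(∂ᵖ)` is a non-zero-divisor when
`N ≠ 0`. -/
theorem evalDPow_mul_ofPoly (N : (ratPow F p)[X]) (q : (RatFunc F)[X]) :
    evalDPow N * DiffOp.ofPoly (ratDeriv F) q = DiffOp.ofPoly (ratDeriv F)
      (expand (RatFunc F) p (N.map (algebraMap (ratPow F p) (RatFunc F))) * q) := by
  rw [← evalDPowHom_apply]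
  induction N using Polynomial.induction_on' with
  | add M N hM hN =>
    rw [map_add, add_mul, hM, hN, Polynomial.map_add, map_add, add_mul, map_add]
  | monomial i f =>
    rw [← C_mul_X_pow_eq_monomial, map_mul, map_pow, evalDPowHom_X, evalDPowHom_C, ← pow_mul,
      mul_assoc, pow_mul, ← evalDPowHom_X, ← map_pow, evalDPowHom_apply,
      (commute_evalDPow _ _).eq, ← evalDPowHom_apply, map_pow, evalDPowHom_X, ← pow_mul,
      DiffOp.ofPoly_mul_D_pow,
      DiffOp.const_mul_ofPoly, Polynomial.map_mul, Polynomial.map_pow, map_C, map_X,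
      map_mul (expand _ p), map_pow (expand _ p), expand_C, expand_X, ← pow_mul, smul_eq_C_mul, mul_right_comm, mul_assoc]
    rfl

theorem eq_zero_of_evalDPow_mul_eq_zero (hp : 0 < p) {N : (ratPow F p)[X]} (hN : N ≠ 0)
    {L : RatDiffOp F} (h : evalDPow N * L = 0) : L = 0 := by
  obtain ⟨q, rfl⟩ := (DiffOp.ofPoly (ratDeriv F)).surjective L
  rw [evalDPow_mul_ofPoly, EmbeddingLike.map_eq_zero_iff, mul_eq_zero, expand_eq_zero hp,
    Polynomial.map_eq_zero] at h
  rw [h.resolve_left hN, map_zero]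

/-- The endomorphism of `F(t)⟨∂⟩` fixing `F(t)` and sending `∂` to `∂ + t⁻¹ c(∂ᵖ)`. -/
noncomputable def twist (c : (ratPow F p)[X]) : RatDiffOp F →+* RatDiffOp F :=
  DiffOp.lift (ratDeriv F) (DiffOp.const (ratDeriv F))
    (DiffOp.D (ratDeriv F) + DiffOp.const (ratDeriv F) RatFunc.X⁻¹ * evalDPow c) fun f => by
      have h : Commute (DiffOp.const (ratDeriv F) RatFunc.X⁻¹) (DiffOp.const (ratDeriv F) f) :=
        (Commute.all _ _).map _
      rw [add_mul, DiffOp.D_mul_const, mul_add,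
        (h.mul_left (commute_evalDPow c (DiffOp.const (ratDeriv F) f))).eq]
      abel

theorem twist_const (c : (ratPow F p)[X]) (f : RatFunc F) :
    twist c (DiffOp.const (ratDeriv F) f) = DiffOp.const (ratDeriv F) f :=
  DiffOp.lift_const _ _ _ _ f

theorem twist_D (c : (ratPow F p)[X]) : twist c (DiffOp.D (ratDeriv F)) =
    DiffOp.D (ratDeriv F) + DiffOp.const (ratDeriv F) RatFunc.X⁻¹ * evalDPow c :=
  DiffOp.lift_D _ _ _ _

theorem twist_D_pow [Fact p.Prime] (c : (ratPow F p)[X]) :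
    twist c (DiffOp.D (ratDeriv F) ^ p) =
      evalDPow (X + C (invXPow F p) * (c ^ p - c)) := by
  have : CharP (RatDiffOp F) p := charP
  have hX : DiffOp.D (ratDeriv F) * DiffOp.const (ratDeriv F) RatFunc.X =
      DiffOp.const (ratDeriv F) RatFunc.X * DiffOp.D (ratDeriv F) + 1 := by
    rw [DiffOp.D_mul_const, ratDeriv_X, map_one]
  rw [map_pow, twist_D, pow_char_add_mul p hX
    (by rw [← map_mul, mul_inv_cancel₀ RatFunc.X_ne_zero, map_one])
    (by rw [← map_mul, inv_mul_cancel₀ RatFunc.X_ne_zero, map_one])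
    (commute_evalDPow c _) (commute_evalDPow c _), ← evalDPowHom_apply, ← evalDPowHom_apply,
    map_add, map_mul, map_sub, map_pow, evalDPowHom_X, evalDPowHom_C, ← map_pow, inv_pow]
  rfl

theorem twist_evalDPow [Fact p.Prime] (c N : (ratPow F p)[X]) :
    twist c (evalDPow N) = evalDPow (N.comp (X + C (invXPow F p) * (c ^ p - c))) := by
  rw [← evalDPowHom_apply, ← evalDPowHom_apply]
  induction N using Polynomial.induction_on' with
  | add M N hM hN => rw [map_add, map_add, hM, hN, add_comp, map_add]
  | monomial i f =>
    rw [← C_mul_X_pow_eq_monomial, map_mul, map_pow, evalDPowHom_X, evalDPowHom_C, map_mul,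
      map_pow, twist_D_pow, twist_const, mul_comp, pow_comp, C_comp, X_comp, map_mul,
      map_pow, evalDPowHom_C, evalDPowHom_apply]

/-- Modulo `N(∂ᵖ)`, the twist and the identity agree on `F(t)` and on `∂`, which determine a ring
homomorphism. -/
theorem dvd_twist_sub {c N : (ratPow F p)[X]} (h : N ∣ c) (L : RatDiffOp F) :
    evalDPow N ∣ twist c L - L := by
  have hmem : ∀ M : RatDiffOp F, M ∈ Ideal.span {evalDPow N} ↔ evalDPow N ∣ M := by
    intro M
    rw [Ideal.mem_span_singleton']
    constructor
    · rintro ⟨P, rfl⟩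
      exact ⟨P, (commute_evalDPow N P).eq.symm⟩
    · rintro ⟨P, rfl⟩
      exact ⟨P, (commute_evalDPow N P).eq.symm⟩
  have hext : (Ideal.Quotient.mk (Ideal.span {evalDPow N})).comp (twist c) =
      Ideal.Quotient.mk (Ideal.span {evalDPow N}) := by
    refine DiffOp.ringHom_ext (fun f => ?_) ?_
    · rw [RingHom.comp_apply, twist_const]
    · rw [RingHom.comp_apply, twist_D]
      refine Ideal.Quotient.eq.mpr ((hmem _).mpr ?_)
      rw [add_sub_cancel_left, ← (commute_evalDPow c _).eq]
      exact (map_dvd (evalDPowHom F p) h).mul_right _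
  rw [← hmem, ← Ideal.Quotient.eq]
  exact DFunLike.congr_fun hext L

end RatDiffOp

/-! ### Conclusion -/

theorem mainTheorem6 (p : ℕ) [Fact p.Prime] (F : Type*) [Field F] [Finite F] [CharP F p]
    (N : (ratPow F p)[X]) (hirr : Irreducible N) (hsep : N.Separable) (ν : ℕ) :
    ∃ e : ((OpQuot (RatDiffOp.evalDPow N))[X] ⧸
          Ideal.span {(X : (OpQuot (RatDiffOp.evalDPow N))[X]) ^ ν}) ≃+*
        OpQuot (RatDiffOp.evalDPow N ^ ν),
      e (Ideal.Quotient.mk _ X) = Ideal.Quotient.mk _ (RatDiffOp.evalDPow N) ∧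
      ∀ f : RatFunc F,
        e (Ideal.Quotient.mk _ (C (Ideal.Quotient.mk _ (DiffOp.const (ratDeriv F) f)))) =
          Ideal.Quotient.mk _ (DiffOp.const (ratDeriv F) f) := by
  -- The constant `w` is `t⁻ᵖ`, the coefficient produced by `twist_D_pow`.
  obtain ⟨c, hNc, hc⟩ := exists_dvd_pow_dvd_comp p hsep (RatDiffOp.invXPow_ne_zero (F := F)) ν
  obtain ⟨e, heX, heC⟩ := exists_ringEquiv_quotient_pow (RatDiffOp.commute_evalDPow N)
    (fun _ => RatDiffOp.eq_zero_of_evalDPow_mul_eq_zero (Fact.out : p.Prime).pos hirr.ne_zero) ν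
    (RatDiffOp.twist c) (RatDiffOp.dvd_twist_sub hNc) (by
      rw [RatDiffOp.twist_evalDPow, ← RatDiffOp.evalDPowHom_apply, ← RatDiffOp.evalDPowHom_apply,
        ← map_pow]
      exact map_dvd _ hc)
  exact ⟨e, heX, fun f => by rw [heC, RatDiffOp.twist_const]⟩
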